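/- Let $G$ be a finite simple plane graph, i.e. a graph together with a drawing in the plane in which vertices are distinct points, edges are polygonal arcs joining their end vertices, no edge contains a vertex other than its ends, and distinct edges meet only in common end vertices. Let $C\subset\mathbb N$ be a finite set of colors and $\chi:V(G)\to 2^C$, such that for every color $c\in C$ the vertices $x$ with $c\in\chi(x)$ induce a connected (possibly empty) subgraph of $G$. Assume that $(G,\chi)$ is irreducible with respect to color contraction, i.e. $\chi(x)\ne\chi(y)$ for any two adjacent vertices $x,y$. Let $s,t\in V(G)$ and $k\in\mathbb N$, so that $(G,C,\chi,s,t,k)$ is an instance of Colored Path$^\star$. For a path $P$ write $\chi(P)=\bigcup_{x\in V(P)}\chi(x)$; $P$ is $k$-valid if $|\chi(P)|\le k$. Let $u,v\in V(G)$, $b\in\mathbb N$, and let $\mathbf P$ be a set of $k$-valid $u$-$v$ paths in $G$ that are pairwise color-disjoint ($\chi(P)\cap\chi(Q)=\emptyset$ for distinct $P,Q\in\mathbf P$), such that no $b$ paths of $\mathbf P$ have a common vertex other than $u$ and $v$. Let $\mathbf P=\{P_1,\dots,P_r\}$ with $r=|\mathbf P|$, where the second vertices $w_1,\dots,w_r$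 of $P_1,\dots,P_r$ are distinct neighbors of $u$ listed in counterclockwise order around $u$ (starting from any one of them). If $1\le i<j\le r$ and $\min\{j-i,\;r+i-j\}>2kb$, then $P_i$ and $P_j$ do not intersect, i.e. they have no common vertex other than $u$ and $v$. -/

import Mathlib

/-- The point set covered by the polygonal line through the listed points of the plane `ℂ = ℝ²`. -/
def polylineTrace : List ℂ → Set ℂ
  | [] => ∅
  | [a] => {a}
  | a :: b :: l => segment ℝ a b ∪ polylineTrace (b :: l)

/-- The polygonal line through the listed points is simple: its segments are nondegenerate and each
of them meets the rest of the line after it only in their common corner. Hence a simple line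
through at least two points is an arc, traversed once from its first to its last point. -/
def IsSimplePolyline : List ℂ → Prop
  | [] => True
  | [_] => True
  | a :: b :: l =>
      a ≠ b ∧ segment ℝ a b ∩ polylineTrace (b :: l) = {b} ∧ IsSimplePolyline (b :: l)

/-- A drawing of `G` in the plane `ℂ = ℝ²` without edge intersections. Vertices are distinct points
and the edges are polygonal arcs joining their end vertices. An edge is described by the list of
its bends, for each of its two orientations (darts). -/
structure PlaneDrawing {V : Type*} (G : SimpleGraph V) where
  /-- the point that represents a vertex -/
  pos : V → ℂ
  /-- the inner corners of the polygonal arc of an edge, from `d.fst` to `d.snd` -/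
  bends : G.Dart → List ℂ
  pos_injective : Function.Injective pos
  bends_symm : ∀ d : G.Dart, bends d.symm = (bends d).reverse
  /-- every edge is an arc -/
  arc_simple : ∀ d : G.Dart, IsSimplePolyline (pos d.fst :: (bends d ++ [pos d.snd]))
  /-- an edge contains no vertices except its ends -/
  vertex_on_arc : ∀ (d : G.Dart) (x : V),
    pos x ∈ polylineTrace (pos d.fst :: (bends d ++ [pos d.snd])) → x = d.fst ∨ x = d.snd
  /-- two different edges meet in vertices only -/
  arc_inter_arc : ∀ d e : G.Dart, d.edge ≠ e.edge → ∀ z : ℂ,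
    z ∈ polylineTrace (pos d.fst :: (bends d ++ [pos d.snd])) →
    z ∈ polylineTrace (pos e.fst :: (bends e ++ [pos e.snd])) → ∃ x : V, pos x = z

namespace PlaneDrawing

variable {V : Type*} {G : SimpleGraph V}

/-- The (unnormalised) direction in which the edge `d` leaves its end vertex `d.fst`: the vector
from `d.fst` to the next corner of the polygonal arc. -/
def direction (D : PlaneDrawing G) (d : G.Dart) : ℂ :=
  (D.bends d).headD (D.pos d.snd) - D.pos d.fst

/-- The neighbors `w 0, …, w (r - 1)` of `u` are listed in counterclockwise order around `u`: the
directions of the edges `u (w i)` at `u` have polar angles that strictly increase with `i` and stay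
within one full turn. The neighbor at which the listing starts is arbitrary. -/
def IsCounterclockwise (D : PlaneDrawing G) (u : V) {r : ℕ} (w : Fin r → V)
    (hw : ∀ i, G.Adj u (w i)) : Prop :=
  ∃ θ : Fin r → ℝ, StrictMono θ ∧ (∀ i j, θ j < θ i + 2 * Real.pi) ∧
    ∀ i, ∃ ρ : ℝ, 0 < ρ ∧
      D.direction ⟨(u, w i), hw i⟩ = (ρ : ℂ) * Complex.exp ((θ i : ℂ) * Complex.I)

end PlaneDrawing

/-- An instance `(G, C, χ, s, t, k)` of the problem Colored Path⋆ except for planarity, which is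
given by a drawing: a graph with a finite set `C` of colors, a set `χ x ⊆ C` of colors at each
vertex `x`, such that every color is connected, two vertices and a number. A color
that appears on no vertex counts as connected. -/
structure ColoredPathInstance (V : Type*) where
  G : SimpleGraph V
  C : Finset ℕ
  χ : V → Finset ℕ
  s : V
  t : V
  k : ℕ
  χ_subset : ∀ x, χ x ⊆ C
  color_connected : ∀ c ∈ C, (G.induce {x | c ∈ χ x}).Preconnected

namespace ColoredPathInstance

variable {V : Type*} (I : ColoredPathInstance V)

/-- No color contraction applies: there are no two adjacent vertices with the same color set. -/
def Irreducible : Prop :=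
  ∀ x y, I.G.Adj x y → I.χ x ≠ I.χ y

open Classical in
/-- The set of colors that appear on the vertices of a walk. -/
noncomputable def colors {x y : V} (W : I.G.Walk x y) : Finset ℕ :=
  I.C.filter (fun c => ∃ z ∈ W.support, c ∈ I.χ z)

/-- A walk is `ℓ`-valid if at most `ℓ` colors appear on its vertices. -/
def IsValid (l : ℕ) {x y : V} (W : I.G.Walk x y) : Prop :=
  (I.colors W).card ≤ l

end ColoredPathInstance

/-! Suppose `P i` and `P j` share an inner vertex `x`. For `m` strictly between `i` and `j` and `n`
outside `[i, j]`, follow `P m` and return along `P n`: a closed curve, perhaps not simple, that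
separates `w i` from `w j` near `u`. Winding angles express this: those around `w i` and `w j`
differ (`windingAngle_ne_of_isCounterclockwise`), while the winding angle is constant along any edge
or color class that misses both paths.

Color classes met by `P i` miss `P m` and `P n`, so only colorless vertices of `P i` can lie on the
curve. Irreducibility forbids two adjacent colorless vertices, and jumping along color classes from
`w i` to `x` leaves at most `k` of them to worry about (`exists_small_separator`). This set depends
on `P i` and `x` only, so `m` and `n` can be chosen after it; likewise for `P j`. Each of these at
most `2k` vertices lies on at most `b - 1` paths, so both ranges of indices contain a path avoiding
them all. Then the winding angles around `w i`, `x` and `w j` agree, a contradiction. -/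

/-! ### Viewing angles of polygonal lines -/

/-- The total angle under which the polygonal line through the listed points is seen from `p`. -/
noncomputable def polylineAngle (p : ℂ) : List ℂ → ℝ
  | [] => 0
  | [_] => 0
  | a :: b :: l => ((b - p) / (a - p)).arg + polylineAngle p (b :: l)

/-- A nonpositive real quotient would exhibit `p` as a convex combination of `a` and `b`. Hence
`arg` is continuous at the quotient for every `p` off the segment. -/
theorem div_sub_mem_slitPlane {a b p : ℂ} (h : p ∉ segment ℝ a b) :
    (b - p) / (a - p) ∈ Complex.slitPlane := by
  have ha : a - p ≠ 0 := fun h0 => h (sub_eq_zero.1 h0 ▸ left_mem_segment ℝ a b)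
  rw [Complex.mem_slitPlane_iff_not_le_zero]
  intro hle
  apply h
  obtain ⟨hre, him⟩ := Complex.le_def.1 hle
  set z := (b - p) / (a - p) with hz
  simp only [Complex.zero_re, Complex.zero_im] at hre him
  have hzr : z = ((z.re : ℝ) : ℂ) := by apply Complex.ext <;> simp [him]
  have hb : b - p = ((z.re : ℝ) : ℂ) * (a - p) := by
    rw [← hzr, hz, div_mul_cancel₀ _ ha]
  have hpos : 0 < 1 - z.re := by linarith
  refine ⟨-z.re / (1 - z.re), 1 / (1 - z.re), div_nonneg (by linarith) hpos.le,
    by positivity, by field_simp; ring, ?_⟩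
  have hne : (1 - (z.re : ℂ)) ≠ 0 := by exact_mod_cast hpos.ne'
  simp only [Complex.real_smul]
  push_cast
  field_simp
  linear_combination hb

theorem mem_polylineTrace_head (a : ℂ) (l : List ℂ) : a ∈ polylineTrace (a :: l) := by
  cases l with
  | nil => simp [polylineTrace]
  | cons b l => exact Or.inl (left_mem_segment ℝ a b)

theorem isPreconnected_polylineTrace (l : List ℂ) : IsPreconnected (polylineTrace l) := by
  induction l with
  | nil => exact isPreconnected_empty
  | cons a l ih =>
    cases l with
    | nil => exact isPreconnected_singleton
    | cons b l =>
      exact (convex_segment a b).isPreconnected.union b (right_mem_segment ℝ a b)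
        (mem_polylineTrace_head b l) ih

theorem mem_polylineTrace_concat (b : ℂ) (l : List ℂ) : b ∈ polylineTrace (l ++ [b]) := by
  induction l with
  | nil => simp [polylineTrace]
  | cons a l ih =>
    cases l with
    | nil => exact Or.inl (right_mem_segment ℝ a b)
    | cons c l => exact Or.inr ih

theorem continuousAt_polylineAngle {p : ℂ} (l : List ℂ) (hp : p ∉ polylineTrace l) :
    ContinuousAt (fun q => polylineAngle q l) p := by
  induction l with
  | nil => exact continuousAt_const
  | cons a l ih =>
    cases l with
    | nil => exact continuousAt_const
    | cons b l =>
      have h1 : p ∉ segment ℝ a b := fun h => hp (Or.inl h)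
      have ha : a - p ≠ 0 := fun h0 => h1 (sub_eq_zero.1 h0 ▸ left_mem_segment ℝ a b)
      refine ContinuousAt.add ?_ (ih fun h => hp (Or.inr h))
      have h2 : ContinuousAt (fun q : ℂ => (b - q) / (a - q)) p :=
        ContinuousAt.div (by fun_prop) (by fun_prop) ha
      exact ContinuousAt.comp (f := fun q : ℂ => (b - q) / (a - q)) (x := p)
        (Complex.continuousAt_arg (div_sub_mem_slitPlane h1)) h2

theorem exp_arg_mul_I {z : ℂ} (hz : z ≠ 0) : Complex.exp (z.arg * Complex.I) = z / ‖z‖ := by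
  have h : (‖z‖ : ℂ) ≠ 0 := by simpa using hz
  rw [eq_div_iff h, mul_comm, Complex.norm_mul_exp_arg_mul_I]

theorem exp_polylineAngle {p : ℂ} (a b : ℂ) (l : List ℂ)
    (hp : p ∉ polylineTrace (a :: (l ++ [b]))) :
    Complex.exp (polylineAngle p (a :: (l ++ [b])) * Complex.I) * ((a - p) / ‖a - p‖) =
      (b - p) / ‖b - p‖ := by
  have key : ∀ a b : ℂ, p ∉ segment ℝ a b →
      Complex.exp (((b - p) / (a - p)).arg * Complex.I) * ((a - p) / ‖a - p‖) =
        (b - p) / ‖b - p‖ := by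
    intro a b h1
    have ha : a - p ≠ 0 := fun h0 => h1 (sub_eq_zero.1 h0 ▸ left_mem_segment ℝ a b)
    have hb : b - p ≠ 0 := fun h0 => h1 (sub_eq_zero.1 h0 ▸ right_mem_segment ℝ a b)
    have ha' : (‖a - p‖ : ℂ) ≠ 0 := by simpa using ha
    have hb' : (‖b - p‖ : ℂ) ≠ 0 := by simpa using hb
    rw [exp_arg_mul_I (div_ne_zero hb ha), norm_div]
    push_cast
    field_simp
  induction l generalizing a with
  | nil =>
    have h1 : p ∉ segment ℝ a b := fun h => hp (Or.inl h)
    simpa [polylineAngle] using key a b h1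
  | cons c l ih =>
    have h1 : p ∉ segment ℝ a c := fun h => hp (Or.inl h)
    have h2 := ih c fun h => hp (Or.inr h)
    rw [← h2, ← key a c h1]
    simp only [List.cons_append, polylineAngle]
    push_cast
    rw [add_mul, Complex.exp_add]
    ring

/-! ### Viewing angles of walks and winding angles -/

namespace PlaneDrawing

variable {V : Type*} {G : SimpleGraph V}

/-- The corners of the polygonal arc that represents an edge. -/
def arc (D : PlaneDrawing G) (d : G.Dart) : List ℂ :=
  D.pos d.fst :: (D.bends d ++ [D.pos d.snd])

/-- The total angle under which the drawing of a walk is seen from `p`. -/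
noncomputable def walkAngle (D : PlaneDrawing G) (p : ℂ) {x y : V} (W : G.Walk x y) : ℝ :=
  (W.darts.map fun d => polylineAngle p (D.arc d)).sum

variable (D : PlaneDrawing G)

theorem walkAngle_cons (p : ℂ) {x y z : V} (h : G.Adj x y) (W : G.Walk y z) :
    D.walkAngle p (SimpleGraph.Walk.cons h W) =
      polylineAngle p (D.arc ⟨(x, y), h⟩) + D.walkAngle p W := by
  simp [walkAngle]

theorem continuousAt_walkAngle {p : ℂ} {x y : V} (W : G.Walk x y)
    (hp : ∀ d ∈ W.darts, p ∉ polylineTrace (D.arc d)) :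
    ContinuousAt (fun q => D.walkAngle q W) p := by
  induction W with
  | nil => exact continuousAt_const
  | cons h W ih =>
    simp only [walkAngle_cons]
    simp only [SimpleGraph.Walk.darts_cons, List.mem_cons, forall_eq_or_imp] at hp
    exact (continuousAt_polylineAngle _ hp.1).add (ih hp.2)

theorem exp_walkAngle {p : ℂ} {x y : V} (W : G.Walk x y)
    (hp : ∀ d ∈ W.darts, p ∉ polylineTrace (D.arc d)) :
    Complex.exp (D.walkAngle p W * Complex.I) * ((D.pos x - p) / ‖D.pos x - p‖) =
      (D.pos y - p) / ‖D.pos y - p‖ := by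
  induction W with
  | nil => simp [walkAngle]
  | cons h W ih =>
    simp only [SimpleGraph.Walk.darts_cons, List.mem_cons, forall_eq_or_imp] at hp
    rw [← ih hp.2, ← exp_polylineAngle _ _ _ hp.1, walkAngle_cons]
    push_cast
    rw [add_mul, Complex.exp_add, arc]
    ring

/-- The winding angle around `p` of the closed curve that consists of two walks with the same
ends. -/
noncomputable def windingAngle {x y : V} (W W' : G.Walk x y) (p : ℂ) : ℝ :=
  D.walkAngle p W - D.walkAngle p W'

/-- By `exp_walkAngle`, both walk angles rotate the direction from `p` to `x` into the direction
from `p` to `y`. -/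
theorem windingAngle_eq_int {p : ℂ} {x y : V} (W W' : G.Walk x y) (hx : D.pos x ≠ p)
    (hW : ∀ d ∈ W.darts, p ∉ polylineTrace (D.arc d))
    (hW' : ∀ d ∈ W'.darts, p ∉ polylineTrace (D.arc d)) :
    ∃ n : ℤ, D.windingAngle W W' p = n * (2 * Real.pi) := by
  have hx' : D.pos x - p ≠ 0 := sub_ne_zero.2 hx
  have h0 : (D.pos x - p) / (‖D.pos x - p‖ : ℂ) ≠ 0 := div_ne_zero hx' (by simpa using hx')
  have h := mul_right_cancel₀ h0 ((D.exp_walkAngle W hW).trans (D.exp_walkAngle W' hW').symm)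
  obtain ⟨n, hn⟩ := Complex.exp_eq_exp_iff_exists_int.1 h
  refine ⟨n, ?_⟩
  have h2 : (D.walkAngle p W : ℂ) = D.walkAngle p W' + n * (2 * Real.pi) := by
    apply mul_right_cancel₀ Complex.I_ne_zero
    rw [hn]; ring
  have h3 : D.walkAngle p W = D.walkAngle p W' + n * (2 * Real.pi) := by exact_mod_cast h2
  rw [windingAngle, h3]; ring

/-- A continuous function on a preconnected set with values in the discrete set of multiples of `2π`
is constant. -/
theorem windingAngle_const {x y : V} (W W' : G.Walk x y) {S : Set ℂ} (hS : IsPreconnected S)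
    (hx : D.pos x ∉ S)
    (hW : ∀ p ∈ S, ∀ d ∈ W.darts, p ∉ polylineTrace (D.arc d))
    (hW' : ∀ p ∈ S, ∀ d ∈ W'.darts, p ∉ polylineTrace (D.arc d))
    {p q : ℂ} (hp : p ∈ S) (hq : q ∈ S) :
    D.windingAngle W W' p = D.windingAngle W W' q := by
  have hpi : (2 * Real.pi) ≠ 0 := by positivity
  have hc : ContinuousOn (fun z => D.windingAngle W W' z / (2 * Real.pi)) S := fun z hz =>
    (((D.continuousAt_walkAngle W (hW z hz)).sub
      (D.continuousAt_walkAngle W' (hW' z hz))).div_const _).continuousWithinAt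
  have hint : Set.MapsTo (fun z => D.windingAngle W W' z / (2 * Real.pi)) S
      (Set.range ((↑) : ℤ → ℝ)) := by
    intro z hz
    obtain ⟨n, hn⟩ := D.windingAngle_eq_int W W' (fun h => hx (h ▸ hz)) (hW z hz) (hW' z hz)
    exact ⟨n, by simp only [hn]; field_simp⟩
  have hd : IsDiscrete (Set.range ((↑) : ℤ → ℝ)) :=
    Int.isClosedEmbedding_coe_real.isEmbedding.isDiscrete_range
  have h := hS.constant_of_mapsTo hd hc hint hp hq
  field_simp at h
  exact h

end PlaneDrawing

/-! ### Winding angles along edges, along color classes, and near `u` -/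

section Winding

open Filter Topology

theorem polylineTrace_cons_subset {a p : ℂ} (b : ℂ) (l : List ℂ) (hp : p ∈ segment ℝ a b) :
    polylineTrace (p :: b :: l) ⊆ polylineTrace (a :: b :: l) :=
  Set.union_subset_union_left _
    ((convex_segment a b).segment_subset hp (right_mem_segment ℝ a b))

namespace PlaneDrawing

variable {V : Type*} {G : SimpleGraph V} (D : PlaneDrawing G)

theorem isPreconnected_arc (d : G.Dart) : IsPreconnected (polylineTrace (D.arc d)) :=
  isPreconnected_polylineTrace _

theorem pos_fst_mem_arc (d : G.Dart) : D.pos d.fst ∈ polylineTrace (D.arc d) :=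
  mem_polylineTrace_head _ _

theorem pos_snd_mem_arc (d : G.Dart) : D.pos d.snd ∈ polylineTrace (D.arc d) :=
  mem_polylineTrace_concat _ (_ :: _)

theorem pos_notMem_arc {x y z : V} {W : G.Walk x y} (hz : z ∉ W.support) :
    ∀ e ∈ W.darts, D.pos z ∉ polylineTrace (D.arc e) := by
  intro e he h
  rcases D.vertex_on_arc e z h with rfl | rfl
  · exact hz (W.dart_fst_mem_support_of_mem_darts he)
  · exact hz (W.dart_snd_mem_support_of_mem_darts he)

/-- An edge whose second end does not lie on a walk meets the walk in its first end at most. -/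
theorem arc_disjoint_walk {x y : V} {W : G.Walk x y} {d : G.Dart} (hd : d.snd ∉ W.support)
    {p : ℂ} (hp : p ∈ polylineTrace (D.arc d)) (hpd : p ≠ D.pos d.fst) :
    ∀ e ∈ W.darts, p ∉ polylineTrace (D.arc e) := by
  intro e he hpe
  have hne : d.edge ≠ e.edge := by
    intro h
    have h1 : d.snd ∈ e.edge := h ▸ Sym2.mem_mk_right _ _
    rcases Sym2.mem_iff.1 h1 with h2 | h2
    · exact hd (h2 ▸ W.dart_fst_mem_support_of_mem_darts he)
    · exact hd (h2 ▸ W.dart_snd_mem_support_of_mem_darts he)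
  obtain ⟨z, rfl⟩ := D.arc_inter_arc d e hne p hp hpe
  rcases D.vertex_on_arc d z hp with rfl | rfl
  · exact hpd rfl
  · exact D.pos_notMem_arc hd e he hpe

theorem windingAngle_eq_of_adj {x y : V} (W W' : G.Walk x y) {a c : V} (hac : G.Adj a c)
    (ha : a ∉ W.support) (ha' : a ∉ W'.support) (hc : c ∉ W.support) (hc' : c ∉ W'.support) :
    D.windingAngle W W' (D.pos a) = D.windingAngle W W' (D.pos c) := by
  have key : ∀ W : G.Walk x y, a ∉ W.support → c ∉ W.support →
      ∀ p ∈ polylineTrace (D.arc ⟨(a, c), hac⟩), ∀ e ∈ W.darts,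
        p ∉ polylineTrace (D.arc e) := by
    intro W ha hc p hp
    by_cases hpa : p = D.pos a
    · exact hpa ▸ D.pos_notMem_arc ha
    · exact D.arc_disjoint_walk (d := ⟨(a, c), hac⟩) hc hp hpa
  refine D.windingAngle_const W W' (D.isPreconnected_arc ⟨(a, c), hac⟩) ?_ (key W ha hc)
    (key W' ha' hc') (D.pos_fst_mem_arc _) (D.pos_snd_mem_arc _)
  intro h
  rcases D.vertex_on_arc ⟨(a, c), hac⟩ x h with rfl | rfl
  · exact ha W.start_mem_support
  · exact hc W.start_mem_support

theorem windingAngle_eq_of_preconnected {x y : V} (W W' : G.Walk x y) {S : Set V}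
    (hS : (G.induce S).Preconnected) (hW : ∀ z ∈ S, z ∉ W.support)
    (hW' : ∀ z ∈ S, z ∉ W'.support) {a c : V} (ha : a ∈ S) (hc : c ∈ S) :
    D.windingAngle W W' (D.pos a) = D.windingAngle W W' (D.pos c) := by
  obtain ⟨Q⟩ := hS ⟨a, ha⟩ ⟨c, hc⟩
  have key : ∀ (a c : S) (_ : (G.induce S).Walk a c),
      D.windingAngle W W' (D.pos a) = D.windingAngle W W' (D.pos c) := by
    intro a c Q
    induction Q with
    | nil => rfl
    | @cons a a' c h Q ih =>
      exact (D.windingAngle_eq_of_adj W W' h (hW a a.2) (hW' a a.2) (hW a' a'.2)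
        (hW' a' a'.2)).trans ih
  exact key _ _ Q

theorem exists_arc_eq (d : G.Dart) :
    ∃ l, D.arc d = D.pos d.fst :: (D.pos d.fst + D.direction d) :: l := by
  rw [arc, direction]
  cases D.bends d with
  | nil => exact ⟨[], by simp⟩
  | cons c l => exact ⟨l ++ [D.pos d.snd], by simp⟩

/-- Seen from a point that approaches the corner of two edges along the second one, the angle of
the first segment of the first edge tends to the angle between the edges minus a straight angle. -/
theorem tendsto_arg_corner (a : ℂ) {ρ σ θ φ : ℝ} (hρ : 0 < ρ) (hσ : 0 < σ) (h : θ ≠ φ)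
    (h1 : θ < φ + 2 * Real.pi) (h2 : φ < θ + 2 * Real.pi) :
    Tendsto (fun ε : ℝ =>
      (((a + ρ * Complex.exp (θ * Complex.I)) - (a + ε * (σ * Complex.exp (φ * Complex.I)))) /
        (a - (a + ε * (σ * Complex.exp (φ * Complex.I))))).arg) (𝓝[>] 0)
      (𝓝 (θ - φ + if φ < θ then -Real.pi else Real.pi)) := by
  -- From a point on the second edge the corner appears in direction `φ + π`; `δ` is the
  -- representative of `θ - φ - π` modulo `2π` in `(-π, π)`.
  set δ : ℝ := θ - φ + if φ < θ then -Real.pi else Real.pi with hδ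
  have hδ1 : -Real.pi < δ ∧ δ < Real.pi := by
    rcases lt_or_gt_of_ne h with h | h
    · rw [if_neg h.not_gt] at hδ; constructor <;> linarith
    · rw [if_pos h] at hδ; constructor <;> linarith
  have hexp : Complex.exp (δ * Complex.I) * Complex.exp (φ * Complex.I) =
      - Complex.exp (θ * Complex.I) := by
    rw [← Complex.exp_add]
    rcases lt_or_gt_of_ne h with h | h
    · rw [if_neg h.not_gt] at hδ
      have : (δ : ℂ) * Complex.I + φ * Complex.I = θ * Complex.I + Real.pi * Complex.I := by
        rw [hδ]; push_cast; ring
      rw [this, Complex.exp_add, Complex.exp_pi_mul_I]; ring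
    · rw [if_pos h] at hδ
      have : (δ : ℂ) * Complex.I + φ * Complex.I = θ * Complex.I - Real.pi * Complex.I := by
        rw [hδ]; push_cast; ring
      rw [this, Complex.exp_sub, Complex.exp_pi_mul_I]; ring
  have hφ : Complex.exp (φ * Complex.I) ≠ 0 := Complex.exp_ne_zero _
  have hσ' : (σ : ℂ) ≠ 0 := by exact_mod_cast hσ.ne'
  have harg : Complex.arg (((ρ / σ : ℝ) : ℂ) * Complex.exp (δ * Complex.I)) = δ := by
    rw [Complex.arg_real_mul _ (by positivity), Complex.exp_mul_I]
    have := Complex.arg_mul_cos_add_sin_mul_I (r := 1) one_pos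
      (θ := δ) ⟨hδ1.1, hδ1.2.le⟩
    simpa using this
  have hslit : ((ρ / σ : ℝ) : ℂ) * Complex.exp (δ * Complex.I) ∈ Complex.slitPlane := by
    rw [Complex.mem_slitPlane_iff_arg]
    refine ⟨harg.trans_ne hδ1.2.ne, mul_ne_zero ?_ (Complex.exp_ne_zero _)⟩
    exact_mod_cast (div_pos hρ hσ).ne'
  have hcont : Tendsto (fun ε : ℝ =>
      ((ρ / σ : ℝ) : ℂ) * Complex.exp (δ * Complex.I) + ε) (𝓝[>] 0)
      (𝓝 (((ρ / σ : ℝ) : ℂ) * Complex.exp (δ * Complex.I))) := by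
    have : Continuous (fun ε : ℝ => ((ρ / σ : ℝ) : ℂ) * Complex.exp (δ * Complex.I) + ε) := by
      fun_prop
    exact tendsto_nhdsWithin_of_tendsto_nhds (by simpa using this.tendsto 0)
  have hlim := (Complex.continuousAt_arg hslit).tendsto.comp hcont
  rw [harg] at hlim
  refine hlim.congr' ?_
  filter_upwards [self_mem_nhdsWithin] with ε hε
  have hε' : (ε : ℂ) ≠ 0 := by exact_mod_cast (ne_of_gt hε)
  -- Scaling by `ε > 0` preserves `arg` and removes the singularity at `ε = 0`.
  have heq : ((ρ / σ : ℝ) : ℂ) * Complex.exp (δ * Complex.I) + ε =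
      (ε : ℂ) * (((a + ρ * Complex.exp (θ * Complex.I)) -
        (a + ε * (σ * Complex.exp (φ * Complex.I)))) /
        (a - (a + ε * (σ * Complex.exp (φ * Complex.I))))) := by
    have hE : Complex.exp (δ * Complex.I) =
        - Complex.exp (θ * Complex.I) / Complex.exp (φ * Complex.I) := by
      rw [eq_div_iff hφ, hexp]
    have hden : a - (a + ε * (σ * Complex.exp (φ * Complex.I))) =
      -(ε * (σ * Complex.exp (φ * Complex.I))) := by ring
    rw [hE, hden]
    push_cast
    field_simp
    ring
  simp only [Function.comp, heq]
  exact Complex.arg_real_mul _ hε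

/-- The part of the angle of a path that is continuous at its first vertex. -/
theorem exists_tendsto_walkAngle {u v : V} (W : G.Walk u v) (hW : W.IsPath) (hadj : G.Adj u W.snd)
    {ρ θ : ℝ} (hρ : 0 < ρ)
    (hdir : D.direction ⟨(u, W.snd), hadj⟩ = ρ * Complex.exp (θ * Complex.I)) :
    ∃ R : ℝ, ∀ σ φ : ℝ, 0 < σ → θ ≠ φ → θ < φ + 2 * Real.pi → φ < θ + 2 * Real.pi →
      Tendsto (fun ε : ℝ => D.walkAngle (D.pos u + ε * (σ * Complex.exp (φ * Complex.I))) W)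
        (𝓝[>] 0) (𝓝 ((θ - φ + if φ < θ then -Real.pi else Real.pi) + R)) := by
  cases W with
  | nil => exact absurd rfl hadj.ne
  | @cons _ y _ h W =>
    rw [SimpleGraph.Walk.cons_isPath_iff] at hW
    have hdir' : D.direction ⟨(u, y), h⟩ = ρ * Complex.exp (θ * Complex.I) := by
      rw [← hdir]; congr 1; ext <;> simp
    obtain ⟨l, hl⟩ := D.exists_arc_eq ⟨(u, y), h⟩
    rw [hdir'] at hl
    set c := D.pos u + ρ * Complex.exp (θ * Complex.I) with hc
    have hu : D.pos u ∉ polylineTrace (c :: l) := by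
      have hs := D.arc_simple ⟨(u, y), h⟩
      rw [← arc, hl] at hs
      intro hmem
      have : D.pos u ∈ ({c} : Set ℂ) := hs.2.1 ▸ ⟨left_mem_segment ℝ _ _, hmem⟩
      exact hs.1 this
    -- Only the first segment touches `u`. The rest contributes `R`, which does not depend on the
    -- direction of approach.
    refine ⟨polylineAngle (D.pos u) (c :: l) + D.walkAngle (D.pos u) W, ?_⟩
    intro σ φ hσ h1 h2 h3
    have hp : Tendsto (fun ε : ℝ => D.pos u + ε * (σ * Complex.exp (φ * Complex.I))) (𝓝[>] 0)
        (𝓝 (D.pos u)) := by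
      have : Continuous (fun ε : ℝ => D.pos u + ε * (σ * Complex.exp (φ * Complex.I))) := by
        fun_prop
      exact tendsto_nhdsWithin_of_tendsto_nhds (by simpa using this.tendsto 0)
    have t1 := (continuousAt_polylineAngle (c :: l) hu).tendsto.comp hp
    have t2 := (D.continuousAt_walkAngle W (D.pos_notMem_arc hW.2)).tendsto.comp hp
    have t3 := tendsto_arg_corner (D.pos u) hρ hσ h1 h2 h3
    refine (t3.add (t1.add t2)).congr fun ε => ?_
    simp only [walkAngle_cons, hl, polylineAngle, Function.comp]
    rw [hc]; ring

/-- The winding angle of two paths from `u` around a neighbor of `u` off the paths is the winding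
angle around the points of the joining edge close to `u`. -/
theorem tendsto_windingAngle {u v z : V} (W W' : G.Walk u v) (hz : G.Adj u z)
    (hW : z ∉ W.support) (hW' : z ∉ W'.support) :
    Tendsto (fun ε : ℝ => D.windingAngle W W' (D.pos u + ε * D.direction ⟨(u, z), hz⟩))
      (𝓝[>] 0) (𝓝 (D.windingAngle W W' (D.pos z))) := by
  -- For `ε ≤ 1` the function is already constant: the remainder of the edge joins the point to `z`
  -- and misses both walks.
  refine tendsto_const_nhds.congr' ?_
  filter_upwards [Ioc_mem_nhdsGT (zero_lt_one' ℝ)] with ε hε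
  obtain ⟨l, hl⟩ := D.exists_arc_eq ⟨(u, z), hz⟩
  have hs := D.arc_simple ⟨(u, z), hz⟩
  rw [← arc, hl] at hs
  simp only at hl hs
  set g := D.direction ⟨(u, z), hz⟩ with hg
  set p := D.pos u + ε * g with hp
  have hg0 : g ≠ 0 := fun h0 => hs.1 (by rw [h0, add_zero])
  have hpseg : p ∈ segment ℝ (D.pos u) (D.pos u + g) := by
    refine ⟨1 - ε, ε, by linarith [hε.2], hε.1.le, by ring, ?_⟩
    simp only [Complex.real_smul, hp]
    push_cast
    ring
  have hpu : p ≠ D.pos u := by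
    have : (ε : ℂ) ≠ 0 := by exact_mod_cast hε.1.ne'
    simp [hp, this, hg0]
  have hsub := polylineTrace_cons_subset (D.pos u + g) l hpseg
  have hu : D.pos u ∉ polylineTrace (p :: (D.pos u + g) :: l) := by
    rintro (h | h)
    · obtain ⟨s, t, hs0, ht0, hst, heq⟩ := h
      simp only [Complex.real_smul, hp] at heq
      have hc : ((s * ε + t : ℝ) : ℂ) * g = 0 := by
        have hst' : (s : ℂ) + t = 1 := by exact_mod_cast hst
        push_cast
        linear_combination heq - D.pos u * hst'
      have hc2 : s * ε + t = 0 := by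
        rcases mul_eq_zero.1 hc with h | h
        · exact_mod_cast h
        · exact absurd h hg0
      have h1 : 0 ≤ s * ε := mul_nonneg hs0 hε.1.le
      have h2 : s * ε = 0 := by linarith
      rcases mul_eq_zero.1 h2 with h3 | h3
      · linarith
      · exact hε.1.ne' h3
    · have : D.pos u ∈ ({D.pos u + g} : Set ℂ) := hs.2.1 ▸ ⟨left_mem_segment ℝ _ _, h⟩
      exact hs.1 this
  have key : ∀ W : G.Walk u v, z ∉ W.support →
      ∀ q ∈ polylineTrace (p :: (D.pos u + g) :: l), ∀ e ∈ W.darts,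
        q ∉ polylineTrace (D.arc e) := by
    intro W hW q hq
    exact D.arc_disjoint_walk (d := ⟨(u, z), hz⟩) hW (hl ▸ hsub hq) fun h => hu (h ▸ hq)
  refine D.windingAngle_const W W' (isPreconnected_polylineTrace _) hu (key W hW) (key W' hW')
    ?_ (mem_polylineTrace_head _ _)
  have h1 : D.pos z ∈ polylineTrace (D.pos u :: (D.pos u + g) :: l) :=
    hl ▸ D.pos_snd_mem_arc ⟨(u, z), hz⟩
  have h2 : D.pos z ∈ polylineTrace ((D.pos u + g) :: l) := by
    have h3 : (D.pos u + g) :: l = D.bends ⟨(u, z), hz⟩ ++ [D.pos z] := (List.cons.inj hl).2.symm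
    rw [h3]
    exact mem_polylineTrace_concat _ _
  exact Or.inr h2

/-- Two paths that start in `u` separate two neighbors of `u` if their first edges do so around
`u`. -/
theorem windingAngle_ne_of_isCounterclockwise {u v : V} {r : ℕ} {w : Fin r → V}
    {hadj : ∀ i, G.Adj u (w i)} (hccw : D.IsCounterclockwise u w hadj) {i j m n : Fin r}
    (him : i < m) (hmj : m < j) (hn : n < i ∨ j < n) {W W' : G.Walk u v}
    (hW : W.IsPath) (hW' : W'.IsPath) (hm : W.snd = w m) (hn' : W'.snd = w n)
    (hi : w i ∉ W.support) (hi' : w i ∉ W'.support)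
    (hj : w j ∉ W.support) (hj' : w j ∉ W'.support) :
    D.windingAngle W W' (D.pos (w i)) ≠ D.windingAngle W W' (D.pos (w j)) := by
  obtain ⟨θ, hθ, hθ2, hdir⟩ := hccw
  choose ρ hρ hdir using hdir
  have hlimit : ∀ (W : G.Walk u v) (m : Fin r), W.IsPath → W.snd = w m →
      ∃ R : ℝ, ∀ k : Fin r, k ≠ m →
        Tendsto (fun ε : ℝ => D.walkAngle (D.pos u + ε * D.direction ⟨(u, w k), hadj k⟩) W)
          (𝓝[>] 0) (𝓝 ((θ m - θ k + if k < m then -Real.pi else Real.pi) + R)) := by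
    intro W m hW hm
    have hd : D.direction ⟨(u, W.snd), hm ▸ hadj m⟩ =
        ρ m * Complex.exp (θ m * Complex.I) := by
      rw [← hdir m]; congr 1; ext <;> simp [hm]
    obtain ⟨R, hR⟩ := D.exists_tendsto_walkAngle W hW (hm ▸ hadj m) (hρ m) hd
    refine ⟨R, fun k hk => ?_⟩
    have := hR (ρ k) (θ k) (hρ k) (fun h => hk (hθ.injective h).symm) (hθ2 k m) (hθ2 m k)
    simp only [hθ.lt_iff_lt] at this
    rw [hdir k]
    exact this
  obtain ⟨R, hR⟩ := hlimit W m hW hm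
  obtain ⟨R', hR'⟩ := hlimit W' n hW' hn'
  have hni : i ≠ n := by rintro rfl; rcases hn with h | h <;> order
  have hnj : j ≠ n := by rintro rfl; rcases hn with h | h <;> order
  have ei := tendsto_nhds_unique (D.tendsto_windingAngle W W' (hadj i) hi hi')
    ((hR i him.ne).sub (hR' i hni))
  have ej := tendsto_nhds_unique (D.tendsto_windingAngle W W' (hadj j) hj hj')
    ((hR j hmj.ne').sub (hR' j hnj))
  -- The `θ` terms leave `θ m - θ n` on both sides. The `±π` term of `W` changes sign between `i`
  -- and `j`; that of `W'` does not, so the values differ by `2π`.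
  rw [ei, ej, if_pos him, if_neg hmj.not_gt]
  have hpi := Real.pi_pos
  intro heq
  rcases hn with h | h
  · rw [if_neg h.not_gt, if_neg (h.trans (him.trans hmj)).not_gt] at heq
    linarith
  · rw [if_pos ((him.trans hmj).trans h), if_pos h] at heq
    linarith

end PlaneDrawing

end Winding

/-! ### Selecting few colorless indices -/

/-- If no two consecutive of the sets `γ a, …, γ n` are empty, then few indices suffice to separate
`a` and `n`: a function that is constant on each color and changes between consecutive indices only
next to a set `Z` of indices off the colors takes the same value at `a` and `n` if `Z` misses
those few indices. -/
theorem exists_small_separating_indices (γ : ℕ → Finset ℕ) (n a : ℕ) (han : a ≤ n)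
    (hγ : ∀ i, a ≤ i → i < n → γ i ≠ ∅ ∨ γ (i + 1) ≠ ∅) :
    ∃ E ⊆ Finset.Icc a n,
      E.card ≤ ((Finset.Icc a n).biUnion γ).card + (if γ a = ∅ then 1 else 0) ∧
      (γ a = ∅ → a ∈ E) ∧
      ∀ (f : ℕ → ℝ) (Z : Set ℕ), (∀ i ∈ Finset.Icc a n, i ∈ Z → γ i = ∅) →
        (∀ i ∈ Finset.Icc a n, ∀ j ∈ Finset.Icc a n, ∀ c, c ∈ γ i → c ∈ γ j → f i = f j) →
        (∀ i, a ≤ i → i < n → i ∉ Z → i + 1 ∉ Z → f i = f (i + 1)) →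
        (∀ e ∈ E, e ∉ Z) → f a = f n := by
  obtain ⟨d, hd⟩ : ∃ d, n - a = d := ⟨_, rfl⟩
  induction d using Nat.strong_induction_on generalizing a with
  | _ d ih =>
  by_cases ha : γ a = ∅
  · rcases han.eq_or_lt with rfl | hlt
    · exact ⟨{a}, by simp, by simp [ha], by simp, fun _ _ _ _ _ _ => rfl⟩
    · obtain ⟨E, hE, hcard, -, hf⟩ := ih (n - (a + 1)) (by omega) (a + 1) hlt
        (fun i hi => hγ i (by omega)) rfl
      have ha1 : γ (a + 1) ≠ ∅ := (hγ a le_rfl hlt).resolve_left (not_not.2 ha)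
      have hsub : Finset.Icc (a + 1) n ⊆ Finset.Icc a n :=
        Finset.Icc_subset_Icc_left (by omega)
      rw [if_neg ha1] at hcard
      refine ⟨insert a E, ?_, ?_, fun _ => Finset.mem_insert_self _ _, ?_⟩
      · exact Finset.insert_subset (by simp [han]) (hE.trans hsub)
      · rw [if_pos ha]
        have h1 := Finset.card_le_card (Finset.biUnion_subset_biUnion_of_subset_left γ hsub)
        have h2 := Finset.card_insert_le a E
        omega
      · intro f Z hZ hc hs hEZ
        rw [hs a le_rfl hlt (hEZ a (Finset.mem_insert_self _ _)) fun h => ha1 (hZ _ (by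
          simp; omega) h)]
        exact hf f Z (fun i hi => hZ i (hsub hi))
          (fun i hi j hj => hc i (hsub hi) j (hsub hj)) (fun i hi => hs i (by omega))
          fun e he => hEZ e (Finset.mem_insert_of_mem he)
  · obtain ⟨c, hc⟩ := Finset.nonempty_iff_ne_empty.2 ha
    set T := (Finset.Icc a n).filter fun i => c ∈ γ i with hT
    have haT : a ∈ T := by simp [hT, han, hc]
    -- Jump to the last index with color `c`. This color is absent from the tail, which pays for `t
    -- + 1` should that index be colorless and hence in `E`.
    obtain ⟨t, htT, htmax⟩ : ∃ t ∈ T, ∀ i ∈ T, i ≤ t :=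
      ⟨T.max' ⟨a, haT⟩, T.max'_mem _, fun i hi => T.le_max' i hi⟩
    obtain ⟨htI, htc⟩ := Finset.mem_filter.1 htT
    obtain ⟨hat, htn⟩ := Finset.mem_Icc.1 htI
    have haI : a ∈ Finset.Icc a n := by simp [han]
    rcases htn.eq_or_lt with rfl | hlt
    · exact ⟨∅, by simp, by simp, fun h => absurd h ha,
        fun f Z _ hcol _ _ => hcol _ haI _ htI c hc htc⟩
    · obtain ⟨E, hE, hcard, hE0, hf⟩ := ih (n - (t + 1)) (by omega) (t + 1) hlt
        (fun i hi => hγ i (by omega)) rfl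
      have hsub : Finset.Icc (t + 1) n ⊆ Finset.Icc a n :=
        Finset.Icc_subset_Icc_left (by omega)
      refine ⟨E, hE.trans hsub, ?_, fun h => absurd h ha, ?_⟩
      · have hlt : ((Finset.Icc (t + 1) n).biUnion γ).card < ((Finset.Icc a n).biUnion γ).card := by
          apply Finset.card_lt_card
          refine Finset.ssubset_iff_subset_ne.2
            ⟨Finset.biUnion_subset_biUnion_of_subset_left γ hsub, fun h => ?_⟩
          have hmem : c ∈ (Finset.Icc (t + 1) n).biUnion γ :=
            h ▸ Finset.mem_biUnion.2 ⟨a, haI, hc⟩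
          obtain ⟨i, hi, hci⟩ := Finset.mem_biUnion.1 hmem
          have := htmax i (Finset.mem_filter.2 ⟨hsub hi, hci⟩)
          have := (Finset.mem_Icc.1 hi).1
          omega
        split_ifs at hcard <;> omega
      · intro f Z hZ hcol hs hEZ
        have ht1 : t + 1 ∈ Finset.Icc a n := by simp; omega
        have h1 : t ∉ Z := fun h => by
          rw [hZ t htI h] at htc
          exact absurd htc (Finset.notMem_empty c)
        have h2 : t + 1 ∉ Z := by
          by_cases h0 : γ (t + 1) = ∅
          · exact hEZ _ (hE0 h0)
          · exact fun h => h0 (hZ _ ht1 h)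
        rw [hcol a haI t htI c hc htc, hs t hat hlt h1 h2]
        exact hf f Z (fun i hi => hZ i (hsub hi))
          (fun i hi j hj => hcol i (hsub hi) j (hsub hj)) (fun i hi => hs i (by omega)) hEZ

/-! ### Small separators on a colored path -/

namespace ColoredPathInstance

variable {V : Type*} (I : ColoredPathInstance V)

theorem mem_colors {x y z : V} {W : I.G.Walk x y} {c : ℕ} (hz : z ∈ W.support)
    (hc : c ∈ I.χ z) : c ∈ I.colors W := by
  rw [colors, Finset.mem_filter]
  exact ⟨I.χ_subset z hc, z, hz, hc⟩

/-- Let `Q` be a path from `u` with at most `k` colors. For every vertex `x` of `Q` there are at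
most `k` inner vertices of `Q` such that the second vertex of `Q` and `x` are not separated by any
two walks that miss these vertices, provided that the walks are color-disjoint from `Q`. -/
theorem exists_small_separator (D : PlaneDrawing I.G) (hI : I.Irreducible) {u v x : V}
    (Q : I.G.Walk u v) (hQ : Q.IsPath) (hk : (I.colors Q).card ≤ I.k) (hw : I.χ Q.snd ≠ ∅)
    (hx : x ∈ Q.support) (hxu : x ≠ u) (hxv : x ≠ v) :
    ∃ E : Finset V, E.card ≤ I.k ∧ (∀ e ∈ E, e ≠ u ∧ e ≠ v) ∧
      ∀ W W' : I.G.Walk u v, Disjoint (I.colors Q) (I.colors W) →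
        Disjoint (I.colors Q) (I.colors W') → (∀ e ∈ E, e ∉ W.support ∧ e ∉ W'.support) →
        D.windingAngle W W' (D.pos Q.snd) = D.windingAngle W W' (D.pos x) := by
  classical
  obtain ⟨n, rfl, hn⟩ := SimpleGraph.Walk.mem_support_iff_exists_getVert.1 hx
  have hn0 : 1 ≤ n := by
    rcases Nat.eq_zero_or_pos n with rfl | h
    · simp at hxu
    · exact h
  have hnl : n < Q.length := lt_of_le_of_ne hn fun h => hxv (by simp [h])
  obtain ⟨E, hE, hcard, -, hf⟩ := exists_small_separating_indices (fun i => I.χ (Q.getVert i)) n 1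
    hn0 (by
      intro i _ hi
      by_contra! h
      exact hI _ _ (Q.adj_getVert_succ (hi.trans hnl)) (h.1.trans h.2.symm))
  refine ⟨E.image Q.getVert, ?_, ?_, ?_⟩
  -- The start `Q.snd` is colored, so the extra `1` in the bound vanishes.
  · rw [if_neg hw] at hcard
    refine Finset.card_image_le.trans (hcard.trans ((Finset.card_le_card ?_).trans hk))
    intro c hc
    obtain ⟨i, -, hi⟩ := Finset.mem_biUnion.1 hc
    exact I.mem_colors (Q.getVert_mem_support i) hi
  · intro e he
    obtain ⟨i, hi, rfl⟩ := Finset.mem_image.1 he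
    obtain ⟨h1, h2⟩ := Finset.mem_Icc.1 (hE hi)
    rw [ne_eq, ne_eq, hQ.getVert_eq_start_iff (by omega), hQ.getVert_eq_end_iff (by omega)]
    omega
  · intro W W' hW hW' hEW
    have hoff : ∀ W : I.G.Walk u v, Disjoint (I.colors Q) (I.colors W) →
        ∀ i c, c ∈ I.χ (Q.getVert i) → ∀ z, c ∈ I.χ z → z ∉ W.support := by
      intro W hW i c hc z hz hzW
      exact Finset.disjoint_left.1 hW (I.mem_colors (Q.getVert_mem_support i) hc)
        (I.mem_colors hzW hz)
    -- `Z` consists of the indices where `Q` meets the closed curve; color-disjointness makes them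
    -- colorless.
    refine hf (fun i => D.windingAngle W W' (D.pos (Q.getVert i)))
      {i | Q.getVert i ∈ W.support ∨ Q.getVert i ∈ W'.support} ?_ ?_ ?_ ?_
    · intro i _ hi
      by_contra h
      obtain ⟨c, hc⟩ := Finset.nonempty_iff_ne_empty.2 h
      exact hi.elim (hoff W hW i c hc _ hc) (hoff W' hW' i c hc _ hc)
    · intro i _ j _ c hi hj
      exact D.windingAngle_eq_of_preconnected W W'
        (I.color_connected c (I.χ_subset _ hi)) (hoff W hW i c hi) (hoff W' hW' i c hi) hi hj
    · intro i _ hi h1 h2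
      rw [Set.mem_ofPred_eq, not_or] at h1 h2
      exact D.windingAngle_eq_of_adj W W' (Q.adj_getVert_succ (hi.trans hnl)) h1.1 h1.2 h2.1 h2.2
    · intro e he
      have := hEW _ (Finset.mem_image_of_mem _ he)
      simpa [not_or] using this

end ColoredPathInstance

/-! ### Counting the paths through the separators -/

theorem mainTheorem7 {V : Type*} [Finite V]
    -- an irreducible instance on a plane graph
    (I : ColoredPathInstance V) (D : PlaneDrawing I.G) (hI : I.Irreducible)
    (u v : V) (b : ℕ)
    -- a set of `k`-valid, pairwise color-disjoint `u`-`v` paths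
    (PP : Set (I.G.Path u v))
    (hvalid : ∀ Q ∈ PP, I.IsValid I.k Q.1)
    (hdisj : ∀ Q ∈ PP, ∀ R ∈ PP, Q ≠ R → Disjoint (I.colors Q.1) (I.colors R.1))
    -- no `b` of the paths have a common vertex besides `u` and `v`
    (hb : ∀ S : Finset (I.G.Path u v), (S : Set (I.G.Path u v)) ⊆ PP → S.card = b →
      ∀ x, (∀ Q ∈ S, x ∈ Q.1.support) → x = u ∨ x = v)
    -- the second vertices of the paths in counterclockwise order around `u`
    (r : ℕ) (w : Fin r → V) (P : Fin r → I.G.Path u v)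
    (hP : Set.BijOn P Set.univ PP)
    (hadj : ∀ i, I.G.Adj u (w i))
    (hw : ∀ i, (P i).1.snd = w i)
    (hccw : D.IsCounterclockwise u w hadj)
    (i j : Fin r) (hij : i < j)
    (hfar : 2 * I.k * b < min ((j : ℕ) - (i : ℕ)) (r + (i : ℕ) - (j : ℕ))) :
    -- the two paths have no common vertex besides `u` and `v`
    ∀ x, x ∈ (P i).1.support → x ∈ (P j).1.support → x = u ∨ x = v := by
  classical
  intro x hxi hxj
  by_contra hx
  obtain ⟨hxu, hxv⟩ := not_or.1 hx
  -- For `b = 0` the empty family would make every vertex equal to `u` or `v`.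
  have hbpos : 0 < b := by
    rcases Nat.eq_zero_or_pos b with h | h
    · exact absurd (hb ∅ (by simp) (by simp [h]) x (by simp)) hx
    · exact h
  have hdisj' : ∀ m n, m ≠ n → Disjoint (I.colors (P m).1) (I.colors (P n).1) := fun m n hmn =>
    hdisj _ (hP.mapsTo trivial) _ (hP.mapsTo trivial)
      fun h => hmn (hP.injOn trivial trivial h)
  have hcommon : ∀ m n, m ≠ n → ∀ y, y ∈ (P m).1.support → y ∈ (P n).1.support → I.χ y = ∅ := by
    intro m n hmn y hm hn
    by_contra h
    obtain ⟨c, hc⟩ := Finset.nonempty_iff_ne_empty.2 h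
    exact Finset.disjoint_left.1 (hdisj' m n hmn) (I.mem_colors hm hc) (I.mem_colors hn hc)
  -- Two color-disjoint paths share `u`, so `u` is colorless. Its neighbors `w m` are then colored
  -- and each lies on its own path only.
  have hu : I.χ u = ∅ :=
    hcommon i j hij.ne u (P i).1.start_mem_support (P j).1.start_mem_support
  have hwne : ∀ m, I.χ (w m) ≠ ∅ := fun m h => hI _ _ (hadj m) (hu.trans h.symm)
  have hwmem : ∀ m, w m ∈ (P m).1.support := fun m => by
    rw [← hw m]; exact (P m).1.getVert_mem_support 1
  have hwoff : ∀ m n, m ≠ n → w m ∉ (P n).1.support := fun m n hmn h =>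
    hwne m (hcommon m n hmn _ (hwmem m) h)
  have hkpos : 0 < I.k := by
    obtain ⟨c, hc⟩ := Finset.nonempty_iff_ne_empty.2 (hwne i)
    exact (Finset.card_pos.2 ⟨c, I.mem_colors (hwmem i) hc⟩).trans_le
      (hvalid _ (hP.mapsTo (Set.mem_univ i)))
  have hthrough : ∀ y, y ≠ u → y ≠ v →
      (Finset.univ.filter fun m => y ∈ (P m).1.support).card ≤ b - 1 := by
    intro y hyu hyv
    by_contra! h
    obtain ⟨S, hS, hcard⟩ := Finset.exists_subset_card_eq (n := b) (by omega :
      b ≤ (Finset.univ.filter fun m => y ∈ (P m).1.support).card)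
    have hinj : Function.Injective P := Set.injOn_univ.1 hP.injOn
    rcases hb (S.image P) (by
        intro Q hQ
        obtain ⟨m, -, rfl⟩ := Finset.mem_image.1 (Finset.mem_coe.1 hQ)
        exact hP.mapsTo trivial)
      (by rw [Finset.card_image_of_injective _ hinj, hcard]) y (by
        intro Q hQ
        obtain ⟨m, hm, rfl⟩ := Finset.mem_image.1 hQ
        exact (Finset.mem_filter.1 (hS hm)).2) with h | h
    · exact hyu h
    · exact hyv h
  obtain ⟨E, hEk, hEuv, hE⟩ := I.exists_small_separator D hI (P i).1 (P i).2
    (hvalid _ (hP.mapsTo trivial)) (by rw [hw]; exact hwne i) hxi hxu hxv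
  obtain ⟨F, hFk, hFuv, hF⟩ := I.exists_small_separator D hI (P j).1 (P j).2
    (hvalid _ (hP.mapsTo trivial)) (by rw [hw]; exact hwne j) hxj hxu hxv
  set bad : Finset (Fin r) :=
    (E ∪ F).biUnion fun y => Finset.univ.filter fun m => y ∈ (P m).1.support with hbad
  -- Strictness, which needs `k` and `b` positive, compensates for the `j - i - 1` and `r + i - j -
  -- 1` indices available for `m` and `n`.
  have hbadcard : bad.card < 2 * I.k * b := by
    have h1 : bad.card ≤ (E ∪ F).card * (b - 1) :=
      Finset.card_biUnion_le_card_mul _ _ _ fun y hy =>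
        (Finset.mem_union.1 hy).elim (fun h => hthrough y (hEuv y h).1 (hEuv y h).2)
          (fun h => hthrough y (hFuv y h).1 (hFuv y h).2)
    have h2 : (E ∪ F).card ≤ 2 * I.k := (Finset.card_union_le E F).trans (by omega)
    calc bad.card ≤ 2 * I.k * (b - 1) := h1.trans (Nat.mul_le_mul_right _ h2)
      _ < 2 * I.k * b := Nat.mul_lt_mul_of_pos_left (by omega) (by omega)
  have hgood : ∀ m, m ∉ bad → ∀ y ∈ E ∪ F, y ∉ (P m).1.support := by
    intro m hm y hy h
    exact hm (Finset.mem_biUnion.2 ⟨y, hy, by simpa using h⟩)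
  obtain ⟨hfar1, hfar2⟩ := lt_min_iff.1 hfar
  have hij' : (i : ℕ) < j := hij
  have hjr := j.2
  obtain ⟨m, hm, hmbad⟩ := Finset.exists_mem_notMem_of_card_lt_card
    (s := bad) (t := Finset.Ioo i j) (by rw [Fin.card_Ioo]; omega)
  obtain ⟨n, hn, hnbad⟩ := Finset.exists_mem_notMem_of_card_lt_card
    (s := bad) (t := (Finset.Icc i j)ᶜ) (by
      rw [Finset.card_compl, Fin.card_Icc, Fintype.card_fin]; omega)
  obtain ⟨him, hmj⟩ := Finset.mem_Ioo.1 hm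
  have hn' : n < i ∨ j < n := by
    by_contra! h
    exact Finset.mem_compl.1 hn (Finset.mem_Icc.2 h)
  have hni : i ≠ n := by rintro rfl; rcases hn' with h | h <;> order
  have hnj : j ≠ n := by rintro rfl; rcases hn' with h | h <;> order
  have e1 := hE (P m).1 (P n).1 (hdisj' i m him.ne) (hdisj' i n hni) fun e he =>
    ⟨hgood m hmbad e (Finset.mem_union_left _ he), hgood n hnbad e (Finset.mem_union_left _ he)⟩
  have e2 := hF (P m).1 (P n).1 (hdisj' j m hmj.ne') (hdisj' j n hnj) fun e he =>
    ⟨hgood m hmbad e (Finset.mem_union_right _ he), hgood n hnbad e (Finset.mem_union_right _ he)⟩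
  rw [hw] at e1 e2
  exact D.windingAngle_ne_of_isCounterclockwise hccw him hmj hn' (P m).2 (P n).2 (hw m) (hw n)
    (hwoff i m him.ne) (hwoff i n hni) (hwoff j m hmj.ne') (hwoff j n hnj) (e1.trans e2.symm)
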